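/- Let $n,k$ be integers with $1\le k\le n-k$, and let $\mathfrak g=\mathfrak{sl}_n(\mathbb C)$ with its Cartan subalgebra of trace-zero diagonal matrices, fundamental weights $\omega_1,\dots,\omega_{n-1}$ (and $\omega_0=\omega_n=0$), and set $\mathcal P_+$ of dominant integral weights. Put $X_{ij}=E_{ij}$ for $i\ne j$, $X_{ii}=E_{ii}-\frac1n\sum_{a}E_{aa}$, and let $$\mathfrak C_p=\sum_{i_1,\dots,i_p=1}^n X_{i_1i_2}X_{i_2i_3}\cdots X_{i_pi_1}$$ in the center of the universal enveloping algebra $U(\mathfrak g)$. For a weight $\mu$ let $V_\mu$ be the irreducible $\mathfrak g$-module with highest weight $\mu$, and let $\chi_\mu(z)$ be the scalar by which a central element $z$ of $U(\mathfrak g)$ acts on $V_\mu$. For a $k$-element subset $I\subseteq\{1,\dots,n\}$ put $\lambda_I=\sum_{i\in I}(-\omega_{i-1}+\omega_i)$, and for a weight $\nu$ put $$f_{\mathfrak C_p,I}(\nu)=\chi_{\nu+\lambda_I}(\mathfrak C_p)-\chi_\nu(\mathfrak C_p)-\chi_{\omega_k}(\mathfrak C_p).$$ This is the eigenvalue on the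 constituent $V_{\nu+\lambda_I}$ of $V_{\omega_k}\otimes V_\nu$ of the operator $M_{\omega_k,\nu}(\mathfrak C_p)$, where $M_{\omega_k,\nu}(z)=\delta(z)-\pi_{\omega_k}(z)\otimes\mathrm{id}-\mathrm{id}\otimes\pi_\nu(z)$; here $\pi_\mu$ denotes the action of $U(\mathfrak g)$ on $V_\mu$ and $\delta$ its action on the tensor product. Let $\nu\in\mathcal P_+$, and let $I\neq J$ be two distinct $k$-element subsets of $\{1,\dots,n\}$ such that $\nu+\lambda_I\in\mathcal P_+$ and $\nu+\lambda_J\in\mathcal P_+$. (a) If $f_{\mathfrak C_p,I}(\nu)=f_{\mathfrak C_p,J}(\nu)$ for all $2\le p\le k$, then $r:=|I\cap J|=0$, i.e. $I$ and $J$ are disjoint. (b) In terms of the operators: if, for every $2\le p\le k$, $M_{\omega_k,\nu}(\mathfrak C_p)$ acts by one and the same scalar on irreducible submodules of $V_{\omega_k}\otimes V_\nu$ with highest weights $\nu+\lambda_I$ and $\nu+\lambda_J$, then again $I\cap J=\emptyset$. -/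

import Mathlib

open scoped TensorProduct

noncomputable section

namespace PTE

attribute [local instance] LieRing.ofAssociativeRing

/-- The special linear Lie algebra `sl_n(ℂ)`. -/
abbrev SL (n : ℕ) : LieSubalgebra ℂ (Matrix (Fin n) (Fin n) ℂ) :=
  LieAlgebra.SpecialLinear.sl (Fin n) ℂ

/-- The universal enveloping algebra `U(sl_n(ℂ))`. -/
abbrev Env (n : ℕ) : Type := UniversalEnvelopingAlgebra ℂ (SL n)

/-- The elements `X_{ij}` of `sl_n(ℂ)`: `X_{ij} = E_{ij}` for `i ≠ j`, and
`X_{ii} = E_{ii} - (1/n) ∑ₐ E_{aa}`. -/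
def X {n : ℕ} (i j : Fin n) : SL n :=
  ⟨Matrix.single i j 1 - if i = j then (1 / (n : ℂ)) • (1 : Matrix (Fin n) (Fin n) ℂ) else 0, by
    have hn : (n : ℂ) ≠ 0 := Nat.cast_ne_zero.mpr (Fin.pos i).ne'
    change Matrix.trace (_ : Matrix (Fin n) (Fin n) ℂ) = 0
    by_cases h : i = j
    · subst h
      simp [Matrix.trace_sub, hn]
    · simp [h]⟩

/-- The matrix `(X_{ij})` with entries in `U(sl_n(ℂ))`. -/
def XMatrix (n : ℕ) : Matrix (Fin n) (Fin n) (Env n) :=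
  Matrix.of fun i j => UniversalEnvelopingAlgebra.ι ℂ (X i j)

/-- The Casimir element
`𝕮_p = ∑_{i₁, …, i_p} X_{i₁ i₂} X_{i₂ i₃} ⋯ X_{i_p i₁}` of `U(sl_n(ℂ))`; the sum over all
`p`-tuples of indices is the trace of the `p`-th power of the matrix `(X_{ij})`. -/
def casimir (n p : ℕ) : Env n := (XMatrix n ^ p).trace

/-- The Cartan subalgebra of `sl_n(ℂ)`: the diagonal matrices of trace zero. -/
def cartan (n : ℕ) : Submodule ℂ (SL n) where
  carrier := {A | ∀ i j : Fin n, i ≠ j → (A : Matrix (Fin n) (Fin n) ℂ) i j = 0}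
  zero_mem' := by intro i j _; simp
  add_mem' := by intro A B hA hB i j h; simp [hA i j h, hB i j h]
  smul_mem' := by intro c A hA i j h; simp [hA i j h]

/-- The weights, i.e. the linear forms on the Cartan subalgebra. -/
abbrev Weight (n : ℕ) : Type := Module.Dual ℂ (cartan n)

/-- The simple coroot `h_j = X_{jj} - X_{j+1,j+1} = E_{jj} - E_{j+1,j+1}`
(here `j` and `j'` are consecutive indices). -/
def coroot {n : ℕ} (j j' : Fin n) : cartan n :=
  ⟨X j j - X j' j', by
    intro a b hab
    have h : ∀ c : Fin n, (Matrix.single c c (1 : ℂ)) a b = 0 := by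
      intro c
      rw [Matrix.single_apply, if_neg]
      rintro ⟨rfl, rfl⟩
      exact hab rfl
    simp [X, h, Matrix.one_apply_ne hab]⟩

/-- `μ` is a dominant integral weight: `μ(h_j)` is a natural number for each simple coroot. -/
def IsDominantIntegral {n : ℕ} (μ : Weight n) : Prop :=
  ∀ j j' : Fin n, (j' : ℕ) = j + 1 → ∃ a : ℕ, μ (coroot j j') = a

/-- The fundamental weight `ω_m`, i.e. the form `A ↦ A₁₁ + ⋯ + A_{mm}` on the Cartan subalgebra;
it satisfies `ω_m(h_j) = δ_{mj}`, and `ω_0 = ω_n = 0`. The index set `{1, …, n}` is modelled by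
`Fin n = {0, …, n-1}`. -/
def fundamentalWeight (n m : ℕ) : Weight n where
  toFun A := ∑ a : Fin n with a.val < m, (A : SL n).1 a a
  map_add' A B := by simp [Finset.sum_add_distrib]
  map_smul' c A := by simp [Finset.mul_sum]

/-- The weight `λ_I = ∑_{i ∈ I} (-ω_{i-1} + ω_i)` of `e_{i₁} ∧ ⋯ ∧ e_{i_k}`, where
`I = {i₁ < ⋯ < i_k}`; the element `i` of `Fin n` stands for the index `i + 1` of `{1, …, n}`. -/
def subsetWeight {n : ℕ} (I : Finset (Fin n)) : Weight n :=
  ∑ i ∈ I, (-fundamentalWeight n i + fundamentalWeight n (i + 1))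

section Modules

variable {n : ℕ} (V : Type*) [AddCommGroup V] [Module ℂ V] [LieRingModule (SL n) V]
  [LieModule ℂ (SL n) V]

/-- `V` is an irreducible `sl_n(ℂ)`-module with highest weight `μ`. -/
def IsIrreducibleOfHighestWeight (μ : Weight n) : Prop :=
  LieModule.IsIrreducible ℂ (SL n) V ∧
    ∃ v : V, v ≠ 0 ∧ (∀ i j : Fin n, i < j → ⁅X i j, v⁆ = 0) ∧
      ∀ h : cartan n, ⁅(h : SL n), v⁆ = μ h • v

/-- The representation `π_V : U(sl_n(ℂ)) → End V` attached to a module `V`. -/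
def envRep : Env n →ₐ[ℂ] Module.End ℂ V :=
  UniversalEnvelopingAlgebra.lift ℂ (LieModule.toEnd ℂ (SL n) V)

variable (W : Type*) [AddCommGroup W] [Module ℂ W] [LieRingModule (SL n) W]
  [LieModule ℂ (SL n) W]

/-- Kostant's operator `M(z) = δ(z) - π_V(z) ⊗ id - id ⊗ π_W(z)` on `V ⊗ W`, where
`δ : U(sl_n(ℂ)) → End V ⊗ End W = End (V ⊗ W)` extends `x ↦ π_V(x) ⊗ id + id ⊗ π_W(x)`
(the action on the tensor product of modules). -/
def kostantOperator (z : Env n) : Module.End ℂ (V ⊗[ℂ] W) :=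
  envRep (V ⊗[ℂ] W) z - TensorProduct.map (envRep V z) LinearMap.id
    - TensorProduct.map LinearMap.id (envRep W z)

end Modules

/-- The infinitesimal central character `χ_μ(z)`, for `z` in the center of `U(sl_n(ℂ))`: the scalar
by which `z` acts on an irreducible module with highest weight `μ` (this module is unique up to
isomorphism). -/
def infChar {n : ℕ} (μ : Weight n) (z : Env n) : ℂ :=
  Classical.epsilon fun c : ℂ =>
    ∃ (V : Type) (_ : AddCommGroup V) (_ : Module ℂ V) (_ : LieRingModule (SL n) V)
      (_ : LieModule ℂ (SL n) V),
      IsIrreducibleOfHighestWeight V μ ∧ ∀ v : V, envRep V z v = c • v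

/-- `f_{𝕮_p, I}(ν) = χ_{ν+λ_I}(𝕮_p) - χ_ν(𝕮_p) - χ_{ω_k}(𝕮_p)`, the eigenvalue of `M(𝕮_p)` on the
constituent `V_{ν+λ_I}` of `V_{ω_k} ⊗ V_ν`. -/
def casimirEigenvalue {n : ℕ} (k : ℕ) (ν : Weight n) (p : ℕ) (I : Finset (Fin n)) : ℂ :=
  infChar (ν + subsetWeight I) (casimir n p) - infChar ν (casimir n p)
    - infChar (fundamentalWeight n k) (casimir n p)

end PTE

end

/-! The Casimir eigenvalues turn into power sums, and Newton's identities then compare the subsets.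
Moving generators past the entries of `XMatrix n ^ p` shows that `casimir n p` acts on a highest
weight vector by a scalar c_p given by a triangular recurrence in the shifted coordinates m_i =
μ(X_ii) + (n - 1 - i). The recurrence telescopes to 1 - t ∑ c_p t^p = ∏ (1 - (m_i + 1) t) / ∏ (1 -
m_i t) (`linProd_mul_casimirSeries`). By logarithmic differentiation, c_0, …, c_k determine ∑ ((m_i
+ 1)^q - m_i^q) for q ≤ k + 1.

For ν + λ_I one has m = b + 1_I, where b is the same for I and J because |I| = |J| = k. The part
summed over all indices cancels, leaving sums over I and J of the second differences of z^q at x_i =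
b_i + 1. These have leading term q (q - 1) x^(q-2), so the power sums of the x_i over I and J agree
in degrees below k. The values c_0 and c_1 agree automatically, which is why p ≥ 2 suffices.

If I and J met, I \ J and J \ I would have at most k - 1 elements and equal power sums up to degree
k - 1, hence the same values x_i. Dominance of ν makes the x_i distinct, so I = J, a contradiction
(`disjoint_of_sum_pow_eq`).

Part (a) also needs irreducible modules of dominant highest weight to exist, since `infChar` is a
choice. They are obtained from products of principal minors. -/

noncomputable section

namespace PTE

attribute [local instance] LieRing.ofAssociativeRing

variable {n : ℕ}

/-! ### Commutation relations and centrality of the Casimir elements -/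

theorem X_bracket (i j k l : Fin n) :
    ⁅(X i j : SL n), X k l⁆ = (if j = k then X i l else 0) - (if i = l then X k j else 0) := by
  apply Subtype.ext
  rw [LieSubalgebra.coe_bracket, Ring.lie_def]
  have h1 : ∀ (A : Matrix (Fin n) (Fin n) ℂ) (c : ℂ) (P : Prop) [Decidable P],
      A * (if P then c • (1 : Matrix (Fin n) (Fin n) ℂ) else 0) = if P then c • A else 0 := by
    intro A c P _; split_ifs <;> simp
  have h2 : ∀ (A : Matrix (Fin n) (Fin n) ℂ) (c : ℂ) (P : Prop) [Decidable P],
      (if P then c • (1 : Matrix (Fin n) (Fin n) ℂ) else 0) * A = if P then c • A else 0 := by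
    intro A c P _; split_ifs <;> simp
  have hc : (X i j : SL n).1 * (X k l : SL n).1 - (X k l : SL n).1 * (X i j : SL n).1 =
      Matrix.single i j 1 * Matrix.single k l 1 - Matrix.single k l 1 * Matrix.single i j 1 := by
    simp only [X, sub_mul, mul_sub, h1, h2]
    split_ifs <;> simp only [smul_sub, smul_smul, sub_zero] <;> module
  rw [hc]
  rcases eq_or_ne j k with rfl | hjk <;> rcases eq_or_ne i l with rfl | hil
  · simp [X]
  · simp [X, hil, hil.symm]
  · simp [X, hjk, hjk.symm]
  · simp [hjk, hil, hil.symm]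

theorem sl_eq_sum (A : SL n) : A = ∑ i, ∑ j, A.1 i j • X i j := by
  apply Subtype.ext
  have hsum : ((∑ i, ∑ j, A.1 i j • X i j : SL n) : Matrix (Fin n) (Fin n) ℂ) =
      ∑ i, ∑ j, A.1 i j • (X i j).1 := by
    rw [AddSubmonoidClass.coe_finsetSum]
    refine Finset.sum_congr rfl fun i _ => ?_
    rw [AddSubmonoidClass.coe_finsetSum]
    rfl
  have htr : ∑ i, A.1 i i = 0 := A.2
  rw [hsum]
  simp only [X, smul_sub, Finset.sum_sub_distrib]
  have h2 : ∑ i, ∑ j, A.1 i j • (if i = j then (1 / (n : ℂ)) •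
      (1 : Matrix (Fin n) (Fin n) ℂ) else 0) = 0 := by
    simp only [smul_ite, smul_zero, Finset.sum_ite_eq, Finset.mem_univ, if_true]
    rw [← Finset.sum_smul, htr, zero_smul]
  rw [h2, sub_zero]
  conv_lhs => rw [Matrix.matrix_eq_sum_single A.1]
  simp

theorem XMatrix_apply (i j : Fin n) :
    XMatrix n i j = UniversalEnvelopingAlgebra.ι ℂ (X i j : SL n) := rfl

/-- The entries of every power transform under the adjoint action like matrix units: the bracket is
a derivation, and in a matrix product the two terms touching the summed middle index cancel. -/
theorem XMatrix_bracket_pow (p : ℕ) (i j k l : Fin n) :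
    ⁅XMatrix n i j, (XMatrix n ^ p) k l⁆ =
      (if j = k then (XMatrix n ^ p) i l else 0) - (if i = l then (XMatrix n ^ p) k j else 0) := by
  induction p generalizing k l with
  | zero =>
    simp only [pow_zero, Matrix.one_apply, Ring.lie_def, mul_ite, ite_mul, mul_one, one_mul,
      mul_zero, zero_mul, sub_self]
    by_cases hjk : j = k <;> by_cases hil : i = l <;> simp [hjk, hil, eq_comm]
  | succ p ih =>
    have hX : ∀ c d : Fin n, XMatrix n i j * XMatrix n c d = XMatrix n c d * XMatrix n i j +
        ((if j = c then XMatrix n i d else 0) - (if i = d then XMatrix n c j else 0)) := by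
      intro c d
      rw [add_comm, ← sub_eq_iff_eq_add, ← Ring.lie_def]
      simp only [XMatrix_apply, ← LieHom.map_lie, X_bracket, map_sub]
      split_ifs <;> simp
    have hT : ∀ c d : Fin n, XMatrix n i j * (XMatrix n ^ p) c d =
        (XMatrix n ^ p) c d * XMatrix n i j +
        ((if j = c then (XMatrix n ^ p) i d else 0) -
          (if i = d then (XMatrix n ^ p) c j else 0)) := by
      intro c d
      rw [add_comm, ← sub_eq_iff_eq_add, ← Ring.lie_def, ih]
    rw [Ring.lie_def, sub_eq_iff_eq_add']
    simp only [pow_succ, Matrix.mul_apply, Finset.mul_sum, Finset.sum_mul]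
    have hterm : ∀ c, XMatrix n i j * ((XMatrix n ^ p) k c * XMatrix n c l) =
        (XMatrix n ^ p) k c * XMatrix n c l * XMatrix n i j +
        ((if j = k then (XMatrix n ^ p) i c * XMatrix n c l else 0) -
          (if i = l then (XMatrix n ^ p) k c * XMatrix n c j else 0)) +
        ((if j = c then (XMatrix n ^ p) k c * XMatrix n i l else 0) -
          (if i = c then (XMatrix n ^ p) k j * XMatrix n c l else 0)) := by
      intro c
      rw [← mul_assoc, hT, add_mul, mul_assoc _ (XMatrix n i j), hX]
      simp only [mul_add, mul_sub, sub_mul, mul_ite, ite_mul, mul_zero, zero_mul, mul_assoc]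
      abel
    simp only [hterm, Finset.sum_add_distrib, Finset.sum_sub_distrib, Finset.sum_ite_eq,
      Finset.mem_univ, if_true, sub_self, add_zero]
    split_ifs <;> simp

theorem ι_mul_casimir (p : ℕ) (x : SL n) :
    UniversalEnvelopingAlgebra.ι ℂ x * casimir n p =
      casimir n p * UniversalEnvelopingAlgebra.ι ℂ x := by
  have key : ∀ i j : Fin n, XMatrix n i j * casimir n p = casimir n p * XMatrix n i j := by
    intro i j
    rw [← sub_eq_zero]
    simp only [casimir, Matrix.trace, Matrix.diag, Finset.mul_sum, Finset.sum_mul]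
    rw [← Finset.sum_sub_distrib]
    simp only [← Ring.lie_def, XMatrix_bracket_pow]
    simp
  rw [sl_eq_sum x]
  simp only [map_sum, map_smul, Finset.sum_mul, Finset.mul_sum, smul_mul_assoc, mul_smul_comm]
  simp only [← XMatrix_apply, key]

/-! ### Casimir eigenvalues from a highest weight vector -/

section Modules

variable {V : Type*} [AddCommGroup V] [Module ℂ V] [LieRingModule (SL n) V]
  [LieModule ℂ (SL n) V]

theorem envRep_ι (x : SL n) (v : V) :
    envRep V (UniversalEnvelopingAlgebra.ι ℂ x) v = ⁅x, v⁆ := by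
  simp [envRep]

/-- The element `X_{ii}` of the Cartan subalgebra. -/
def diagX (i : Fin n) : cartan n :=
  ⟨X i i, by
    intro a b hab
    have h : (Matrix.single i i (1 : ℂ)) a b = 0 := by
      rw [Matrix.single_apply, if_neg]
      rintro ⟨rfl, rfl⟩
      exact hab rfl
    simp [X, h, Matrix.one_apply_ne hab]⟩

/-- The eigenvalues of the diagonal entries of `(X_{ij})^p` on a highest weight vector, where
`m i` is the `i`-th coordinate of the weight shifted by `n - 1 - i`. -/
def diagScalar (m : Fin n → ℂ) : ℕ → Fin n → ℂ
  | 0, _ => 1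
  | p + 1, i => m i * diagScalar m p i - ∑ k ∈ Finset.Ioi i, diagScalar m p k

/-- The shifted coordinates `μ_i + (n - 1 - i)` of a weight. -/
def shiftedCoord (μ : Weight n) (i : Fin n) : ℂ := μ (diagX i) + ((n - 1 - i : ℕ) : ℂ)

/-- In ∑_k (X^p)_ik X_ki v the terms k < i vanish, k = i contributes the weight, and each k > i
contributes d_i - d_k after commuting, where d_i is the eigenvalue of (X^p)_ii. The n - 1 - i copies
of d_i account for the shift in `shiftedCoord`. -/
theorem envRep_pow_highestWeight {μ : Weight n} {v : V}
    (hv : ∀ i j : Fin n, i < j → ⁅(X i j : SL n), v⁆ = 0)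
    (hμ : ∀ h : cartan n, ⁅(h : SL n), v⁆ = μ h • v) (p : ℕ) :
    (∀ i j : Fin n, i < j → envRep V ((XMatrix n ^ p) i j) v = 0) ∧
      ∀ i : Fin n, envRep V ((XMatrix n ^ p) i i) v = diagScalar (shiftedCoord μ) p i • v := by
  induction p with
  | zero =>
    refine ⟨fun i j hij => by simp [Matrix.one_apply_ne hij.ne], fun i => by simp [diagScalar]⟩
  | succ p ih =>
    obtain ⟨ih1, ih2⟩ := ih
    -- The generator is moved to the left, so that only entries of the p-th power act on `v` and the
    -- induction hypothesis applies.
    have hcomm : ∀ i j k : Fin n, envRep V ((XMatrix n ^ p) i k * XMatrix n k j) v =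
        envRep V (XMatrix n k j) (envRep V ((XMatrix n ^ p) i k) v) -
          ((if j = i then envRep V ((XMatrix n ^ p) k k) v else 0) -
            envRep V ((XMatrix n ^ p) i j) v) := by
      intro i j k
      have h := XMatrix_bracket_pow (n := n) p k j i k
      rw [Ring.lie_def, sub_eq_iff_eq_add', ← sub_eq_iff_eq_add] at h
      rw [← h, map_sub, LinearMap.sub_apply, map_mul, Module.End.mul_apply]
      simp only [if_true, map_sub, LinearMap.sub_apply]
      split_ifs <;> simp
    have hlt : ∀ i j k : Fin n, k < j → envRep V ((XMatrix n ^ p) i k * XMatrix n k j) v = 0 := by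
      intro i j k hkj
      rw [map_mul, Module.End.mul_apply, XMatrix_apply, envRep_ι, hv k j hkj, map_zero]
    have heq : ∀ i j : Fin n, envRep V ((XMatrix n ^ p) i j * XMatrix n j j) v =
        μ (diagX j) • envRep V ((XMatrix n ^ p) i j) v := by
      intro i j
      rw [map_mul, Module.End.mul_apply, XMatrix_apply, envRep_ι]
      have : ⁅(X j j : SL n), v⁆ = _ := hμ (diagX j)
      rw [this, map_smul]
    refine ⟨fun i j hij => ?_, fun i => ?_⟩
    · rw [pow_succ, Matrix.mul_apply, map_sum, LinearMap.sum_apply]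
      refine Finset.sum_eq_zero fun k _ => ?_
      rcases lt_trichotomy k j with hkj | rfl | hjk
      · exact hlt i j k hkj
      · rw [heq, ih1 _ _ hij, smul_zero]
      · rw [hcomm, ih1 _ _ hij, ih1 _ _ (hij.trans hjk), if_neg hij.ne']
        simp
    · rw [pow_succ, Matrix.mul_apply, map_sum, LinearMap.sum_apply]
      have hterm : ∀ k, envRep V ((XMatrix n ^ p) i k * XMatrix n k i) v =
          (if k = i then μ (diagX i) * diagScalar (shiftedCoord μ) p i else 0) • v +
          (if i < k then diagScalar (shiftedCoord μ) p i - diagScalar (shiftedCoord μ) p k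
            else 0) • v := by
        intro k
        rcases lt_trichotomy k i with hkj | rfl | hjk
        · rw [hlt _ _ _ hkj, if_neg hkj.ne, if_neg hkj.not_gt]
          simp
        · rw [heq, ih2, smul_smul, if_pos rfl, if_neg (lt_irrefl _), zero_smul, add_zero]
        · rw [hcomm, ih1 _ _ hjk, if_pos rfl, if_neg hjk.ne', if_pos hjk, ih2, ih2]
          simp [sub_smul]
      simp only [hterm, Finset.sum_add_distrib, ← Finset.sum_smul, ← add_smul]
      congr 1
      rw [Finset.sum_ite_eq' , if_pos (Finset.mem_univ _), ← Finset.sum_filter,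
        Finset.filter_lt_eq_Ioi, Finset.sum_sub_distrib, Finset.sum_const, Fin.card_Ioi,
        diagScalar, shiftedCoord, nsmul_eq_mul]
      ring

/-- The scalar by which `casimir n p` acts on a highest weight vector of weight `μ`. -/
def casimirScalar (μ : Weight n) (p : ℕ) : ℂ := ∑ i, diagScalar (shiftedCoord μ) p i

/-- By centrality the eigenspace is a submodule; it contains the highest weight vector, so
irreducibility makes it everything. No finite-dimensionality is needed. -/
theorem IsIrreducibleOfHighestWeight.envRep_casimir {μ : Weight n}
    (hV : IsIrreducibleOfHighestWeight V μ) (p : ℕ) (x : V) :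
    envRep V (casimir n p) x = casimirScalar μ p • x := by
  obtain ⟨hirr, v, hv0, hv, hμ⟩ := hV
  let N : LieSubmodule ℂ (SL n) V :=
    { LinearMap.ker (envRep V (casimir n p) - casimirScalar μ p • LinearMap.id) with
      lie_mem := by
        intro x m hm
        change m ∈ LinearMap.ker _ at hm
        change _ ∈ LinearMap.ker _
        rw [LinearMap.mem_ker] at hm ⊢
        simp only [LinearMap.sub_apply, LinearMap.smul_apply, LinearMap.id_apply,
          sub_eq_zero] at hm ⊢
        rw [← envRep_ι, ← Module.End.mul_apply, ← map_mul, ← ι_mul_casimir, map_mul,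
          Module.End.mul_apply, hm, map_smul] }
  have hmem : ∀ y, y ∈ N ↔ envRep V (casimir n p) y = casimirScalar μ p • y := by
    intro y
    change y ∈ LinearMap.ker _ ↔ _
    simp [sub_eq_zero]
  have hvN : v ∈ N := by
    rw [hmem, casimir, Matrix.trace, map_sum, LinearMap.sum_apply, casimirScalar, Finset.sum_smul]
    exact Finset.sum_congr rfl fun i _ => (envRep_pow_highestWeight hv hμ p).2 i
  have hN : N = ⊤ := (eq_bot_or_eq_top N).resolve_left fun h => by
    rw [h] at hvN
    exact hv0 (by simpa using hvN)
  rw [← hmem, hN]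
  trivial

end Modules

/-! ### Generating series of the Casimir eigenvalues -/

/-- The power series `1 - t ∑_p c_p t^p`, where `c_p` is the sum of the `diagScalar m p i`. -/
def casimirSeries (m : Fin n → ℂ) : PowerSeries ℂ :=
  1 - PowerSeries.X * ∑ i, PowerSeries.mk fun p => diagScalar m p i

/-- The power series `∏ (1 - f_i t)`. -/
def linProd {ι : Type*} (s : Finset ι) (f : ι → ℂ) : PowerSeries ℂ :=
  ∏ i ∈ s, (1 - PowerSeries.C (f i) * PowerSeries.X)

/-- The generating series `∑_j (∑_i f_i ^ (j + 1)) t ^ j` of the power sums. -/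
def powerSumSeries {ι : Type*} (s : Finset ι) (f : ι → ℂ) : PowerSeries ℂ :=
  PowerSeries.mk fun j => ∑ i ∈ s, f i ^ (j + 1)

theorem mk_diagScalar (m : Fin n → ℂ) (i : Fin n) :
    (1 - PowerSeries.C (m i) * PowerSeries.X) * PowerSeries.mk (fun p => diagScalar m p i) =
      1 - PowerSeries.X * ∑ k ∈ Finset.Ioi i, PowerSeries.mk fun p => diagScalar m p k := by
  ext p
  rw [sub_mul, one_mul, mul_assoc]
  cases p with
  | zero => simp [diagScalar]
  | succ p =>
    simp [PowerSeries.coeff_succ_X_mul, PowerSeries.coeff_one, diagScalar]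

theorem linProd_mul_casimirSeries (m : Fin n → ℂ) :
    linProd Finset.univ m * casimirSeries m = linProd Finset.univ fun i => m i + 1 := by
  -- The recurrence at an index involves exactly the larger ones, so indices are added in decreasing
  -- order; adding `a` multiplies the partial series by (1 - (m_a + 1) t) / (1 - m_a t).
  have key : ∀ s : Finset (Fin n), IsUpperSet (s : Set (Fin n)) →
      linProd s m * (1 - PowerSeries.X * ∑ i ∈ s, PowerSeries.mk fun p => diagScalar m p i) =
        linProd s fun i => m i + 1 := by
    intro s
    induction s using Finset.induction_on_min with
    | empty => intro _; simp [linProd]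
    | insert a s ha ih =>
      intro hup
      have has : a ∉ s := fun h => lt_irrefl _ (ha a h)
      have hs : IsUpperSet (s : Set (Fin n)) := by
        intro x y hxy hx
        have hy := hup hxy (Finset.mem_coe.2 (Finset.mem_insert_of_mem hx))
        rcases Finset.mem_insert.1 (Finset.mem_coe.1 hy) with rfl | h
        · exact absurd (ha x hx) hxy.not_gt
        · exact h
      have hIoi : Finset.Ioi a = s := by
        ext x
        rw [Finset.mem_Ioi]
        refine ⟨fun h => ?_, ha x⟩
        have hx := hup h.le (Finset.mem_coe.2 (Finset.mem_insert_self a s))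
        rcases Finset.mem_insert.1 (Finset.mem_coe.1 hx) with rfl | h'
        · exact absurd h (lt_irrefl _)
        · exact h'
      have h1 := ih hs
      have h2 := mk_diagScalar m a
      rw [hIoi] at h2
      simp only [linProd, Finset.prod_insert has, Finset.sum_insert has, map_add, map_one] at h1 ⊢
      rw [← h1]
      linear_combination (-PowerSeries.X * ∏ i ∈ s, (1 - PowerSeries.C (m i) * PowerSeries.X)) * h2
  exact key Finset.univ (by simp [isUpperSet_univ])

theorem derivative_linProd {ι : Type*} (s : Finset ι) (f : ι → ℂ) :
    PowerSeries.derivative ℂ (linProd s f) = -linProd s f * powerSumSeries s f := by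
  classical
  induction s using Finset.induction_on with
  | empty => simp [linProd, powerSumSeries, PowerSeries.ext_iff]
  | insert a s ha ih =>
    have hsplit : powerSumSeries (insert a s) f =
        PowerSeries.mk (fun j => f a ^ (j + 1)) + powerSumSeries s f := by
      ext j; simp [powerSumSeries, Finset.sum_insert ha]
    have hgeom : (1 - PowerSeries.C (f a) * PowerSeries.X) *
        PowerSeries.mk (fun j => f a ^ (j + 1)) = PowerSeries.C (f a) := by
      ext j
      rw [sub_mul, one_mul, mul_assoc]
      cases j with
      | zero => simp
      | succ j => simp [PowerSeries.coeff_succ_X_mul, pow_succ']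
    have hd : PowerSeries.derivative ℂ (1 - PowerSeries.C (f a) * PowerSeries.X) =
        -PowerSeries.C (f a) := by
      simp [Derivation.leibniz]
    have hp : linProd (insert a s) f =
        (1 - PowerSeries.C (f a) * PowerSeries.X) * linProd s f := by
      simp [linProd, Finset.prod_insert ha]
    rw [hp, hsplit, Derivation.leibniz, ih, hd, smul_eq_mul, smul_eq_mul]
    linear_combination linProd s f * hgeom

theorem constantCoeff_linProd {ι : Type*} (s : Finset ι) (f : ι → ℂ) :
    PowerSeries.constantCoeff (linProd s f) = 1 := by
  simp [linProd, map_prod]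

theorem linProd_ne_zero {ι : Type*} (s : Finset ι) (f : ι → ℂ) : linProd s f ≠ 0 := fun h => by
  simpa [h] using constantCoeff_linProd s f

theorem derivative_casimirSeries (m : Fin n → ℂ) :
    PowerSeries.derivative ℂ (casimirSeries m) = casimirSeries m *
      (powerSumSeries Finset.univ m - powerSumSeries Finset.univ fun i => m i + 1) := by
  have h := linProd_mul_casimirSeries m
  have hd := congrArg (PowerSeries.derivative ℂ) h
  rw [Derivation.leibniz, derivative_linProd, derivative_linProd, ← h, smul_eq_mul,
    smul_eq_mul] at hd
  apply mul_left_cancel₀ (linProd_ne_zero Finset.univ m)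
  linear_combination hd

theorem dvd_derivative {k : ℕ} {f : PowerSeries ℂ} (h : PowerSeries.X ^ (k + 1) ∣ f) :
    PowerSeries.X ^ k ∣ PowerSeries.derivative ℂ f := by
  rw [PowerSeries.X_pow_dvd_iff] at h ⊢
  intro j hj
  rw [PowerSeries.coeff_derivative, h _ (by omega), zero_mul]

/-- The factor t in `casimirSeries` puts c_p in degree p + 1, so the series agree modulo t^(k+2) and
their logarithmic derivatives modulo t^(k+1). The coefficient of t^j there carries exponent j + 1,
whence q ≤ k + 1. -/
theorem sum_pow_sub_pow_eq {k : ℕ} {m m' : Fin n → ℂ}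
    (h : ∀ p ≤ k, ∑ i, diagScalar m p i = ∑ i, diagScalar m' p i) (q : ℕ) (hq : q ≤ k + 1) :
    ∑ i, ((m i + 1) ^ q - m i ^ q) = ∑ i, ((m' i + 1) ^ q - m' i ^ q) := by
  have hS : PowerSeries.X ^ (k + 2) ∣ casimirSeries m - casimirSeries m' := by
    rw [PowerSeries.X_pow_dvd_iff]
    intro j hj
    cases j with
    | zero => simp [casimirSeries]
    | succ j => simp [casimirSeries, PowerSeries.coeff_succ_X_mul, h j (by omega)]
  have hc : ∀ m : Fin n → ℂ, IsUnit (casimirSeries m) := fun m =>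
    PowerSeries.isUnit_iff_constantCoeff.2 (by simp [casimirSeries])
  set D : (Fin n → ℂ) → PowerSeries ℂ := fun m =>
    powerSumSeries Finset.univ m - powerSumSeries Finset.univ fun i => m i + 1 with hD
  have hdvd : PowerSeries.X ^ (k + 1) ∣ D m - D m' := by
    have h1 : PowerSeries.X ^ (k + 1) ∣ casimirSeries m * (casimirSeries m' * (D m - D m')) := by
      have h2 : casimirSeries m * (casimirSeries m' * (D m - D m')) =
          PowerSeries.derivative ℂ (casimirSeries m - casimirSeries m') * casimirSeries m' -
            PowerSeries.derivative ℂ (casimirSeries m') *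
              (casimirSeries m - casimirSeries m') := by
        rw [map_sub, derivative_casimirSeries, derivative_casimirSeries]
        ring
      rw [h2]
      exact dvd_sub (Dvd.dvd.mul_right (dvd_derivative hS) _)
        (Dvd.dvd.mul_left ((pow_dvd_pow _ (by omega)).trans hS) _)
    exact (hc m').dvd_mul_left.1 ((hc m).dvd_mul_left.1 h1)
  cases q with
  | zero => simp
  | succ q =>
    have := PowerSeries.X_pow_dvd_iff.1 hdvd q (by omega)
    simp only [hD, powerSumSeries, map_sub, PowerSeries.coeff_mk, Finset.sum_sub_distrib]
      at this ⊢
    linear_combination -this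

/-! ### From second differences to power sums -/

theorem sum_add_indicator {ι : Type*} [Fintype ι] [DecidableEq ι] (φ : ℂ → ℂ) (b : ι → ℂ)
    (I : Finset ι) :
    ∑ i, φ (b i + if i ∈ I then 1 else 0) = ∑ i, φ (b i) + ∑ i ∈ I, (φ (b i + 1) - φ (b i)) := by
  rw [← sub_eq_iff_eq_add', ← Finset.sum_sub_distrib, ← Finset.sum_subset (Finset.subset_univ I)]
  · exact Finset.sum_congr rfl fun i hi => by rw [if_pos hi]
  · intro i _ hi
    rw [if_neg hi]; simp

theorem second_difference_pow (x : ℂ) (j : ℕ) :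
    (x + 1) ^ (j + 2) - 2 * x ^ (j + 2) + (x - 1) ^ (j + 2) =
      ((j : ℂ) + 2) * (j + 1) * x ^ j +
        ∑ l ∈ Finset.range j,
          (1 + (-1 : ℂ) ^ (j + 2 - l)) * ((j + 2).choose l : ℂ) * x ^ l := by
  have h2 : ((j + 2).choose j : ℂ) * 2 = ((j : ℂ) + 2) * (j + 1) := by
    have h3 : (j + 2).choose j = (j + 2).choose 2 := by
      rw [← Nat.choose_symm (by omega : 2 ≤ j + 2)]; simp
    have h4 : (j + 2).choose 2 * 2 = (j + 2) * (j + 1) := by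
      rw [Nat.choose_two_right]
      exact Nat.div_mul_cancel (Nat.even_mul_pred_self (j + 2)).two_dvd
    rw [h3]
    exact_mod_cast h4
  rw [sub_eq_add_neg x 1, add_pow, add_pow]
  have e1 : j + 2 - (j + 1) = 1 := by omega
  have e2 : j + 2 - j = 2 := by omega
  simp only [Finset.sum_range_succ, Nat.choose_self, Nat.choose_succ_self_right, e1, e2,
    Nat.sub_self, one_pow, mul_one, add_mul, one_mul, Finset.sum_add_distrib]
  have e3 : ∀ l, x ^ l * (-1) ^ (j + 2 - l) * ((j + 2).choose l : ℂ) =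
      (-1) ^ (j + 2 - l) * ((j + 2).choose l : ℂ) * x ^ l := fun l => by ring
  have e4 : ∀ l, x ^ l * ((j + 2).choose l : ℂ) = ((j + 2).choose l : ℂ) * x ^ l :=
    fun l => by ring
  simp only [e3, e4]
  push_cast
  linear_combination x ^ j * h2

/-- A triangular system: the second difference of z^(j+2) is a nonzero multiple of x^j plus lower
powers, so the power sums are recovered by strong induction. Two degrees are lost. -/
theorem sum_pow_eq_of_second_difference {ι : Type*} {s t : Finset ι} {x : ι → ℂ} {k : ℕ}
    (h : ∀ q ≤ k + 1, ∑ i ∈ s, ((x i + 1) ^ q - 2 * x i ^ q + (x i - 1) ^ q) =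
      ∑ i ∈ t, ((x i + 1) ^ q - 2 * x i ^ q + (x i - 1) ^ q)) (j : ℕ) (hj : j < k) :
    ∑ i ∈ s, x i ^ j = ∑ i ∈ t, x i ^ j := by
  induction j using Nat.strong_induction_on with
  | _ j ih =>
    have hq := h (j + 2) (by omega)
    simp only [second_difference_pow, Finset.sum_add_distrib, ← Finset.mul_sum] at hq
    rw [Finset.sum_comm, Finset.sum_comm (s := t)] at hq
    simp only [← Finset.mul_sum] at hq
    have hlow : ∀ l ∈ Finset.range j, (1 + (-1 : ℂ) ^ (j + 2 - l)) * ((j + 2).choose l : ℂ) *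
        ∑ i ∈ s, x i ^ l = (1 + (-1 : ℂ) ^ (j + 2 - l)) * ((j + 2).choose l : ℂ) *
        ∑ i ∈ t, x i ^ l := fun l hl => by
      rw [ih l (Finset.mem_range.1 hl) ((Finset.mem_range.1 hl).trans hj)]
    rw [Finset.sum_congr rfl hlow] at hq
    have hne : ((j : ℂ) + 2) * (j + 1) ≠ 0 := by
      exact_mod_cast (by positivity : (j + 2) * (j + 1) ≠ 0)
    exact mul_left_cancel₀ hne (add_right_cancel hq)

/-! ### From power sums to subsets -/

theorem coeff_linProd_of_lt {ι : Type*} (s : Finset ι) (f : ι → ℂ) {e : ℕ} (he : s.card < e) :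
    PowerSeries.coeff e (linProd s f) = 0 := by
  classical
  induction s using Finset.induction_on generalizing e with
  | empty =>
    rw [Finset.card_empty] at he
    simp [linProd, PowerSeries.coeff_one, he.ne']
  | insert a s ha ih =>
    rw [Finset.card_insert_of_notMem ha] at he
    obtain ⟨e, rfl⟩ : ∃ e', e = e' + 1 := ⟨e - 1, by omega⟩
    have hp : linProd (insert a s) f =
        linProd s f - PowerSeries.C (f a) * (PowerSeries.X * linProd s f) := by
      simp only [linProd, Finset.prod_insert ha]; ring
    rw [hp, map_sub, PowerSeries.coeff_C_mul, PowerSeries.coeff_succ_X_mul, ih (by omega),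
      ih (by omega)]
    simp

/-- Newton's identities in generating-function form: logarithmic derivatives agreeing modulo t^k
force agreement through degree k, and neither product has terms beyond that. -/
theorem linProd_eq_of_sum_pow_eq {ι : Type*} {s t : Finset ι} {f : ι → ℂ} {k : ℕ}
    (hs : s.card ≤ k) (ht : t.card ≤ k)
    (h : ∀ j, 1 ≤ j → j ≤ k → ∑ i ∈ s, f i ^ j = ∑ i ∈ t, f i ^ j) :
    linProd s f = linProd t f := by
  have hp : PowerSeries.X ^ k ∣ powerSumSeries t f - powerSumSeries s f := by
    rw [PowerSeries.X_pow_dvd_iff]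
    intro j hj
    simp [powerSumSeries, h (j + 1) (by omega) (by omega)]
  set H := linProd s f - linProd t f with hH
  have hdvd : PowerSeries.X ^ k ∣ PowerSeries.derivative ℂ H * linProd t f -
      PowerSeries.derivative ℂ (linProd t f) * H := by
    have : PowerSeries.derivative ℂ H * linProd t f - PowerSeries.derivative ℂ (linProd t f) * H =
        linProd s f * linProd t f * (powerSumSeries t f - powerSumSeries s f) := by
      rw [hH, map_sub, derivative_linProd, derivative_linProd]
      ring
    rw [this]
    exact Dvd.dvd.mul_left hp _
  have hunit : IsUnit (linProd t f) :=
    PowerSeries.isUnit_iff_constantCoeff.2 (by simp [constantCoeff_linProd])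
  -- Bootstrapping: if t^e divides H with 1 ≤ e ≤ k, it divides H' times a unit, so e times the t^e
  -- coefficient of H is zero and the order of vanishing rises by one.
  have hlow : ∀ e ≤ k + 1, PowerSeries.X ^ e ∣ H := by
    intro e
    induction e with
    | zero => simp
    | succ e ih =>
      intro he
      have hX := ih (by omega)
      rw [PowerSeries.X_pow_dvd_iff]
      intro j hj
      rcases (Nat.lt_succ_iff.1 hj).lt_or_eq with hj | rfl
      · exact PowerSeries.X_pow_dvd_iff.1 hX j hj
      · cases j with
        | zero => simp [hH, constantCoeff_linProd]
        | succ j =>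
          have h1 : PowerSeries.X ^ (j + 1) ∣ PowerSeries.derivative ℂ H * linProd t f := by
            have h2 := dvd_add ((pow_dvd_pow _ (by omega)).trans hdvd)
              (Dvd.dvd.mul_left hX (PowerSeries.derivative ℂ (linProd t f)))
            rwa [sub_add_cancel] at h2
          have h3 := PowerSeries.X_pow_dvd_iff.1 (hunit.dvd_mul_right.1 h1) j (by omega)
          rw [PowerSeries.coeff_derivative] at h3
          exact (mul_eq_zero.1 h3).resolve_right (by exact_mod_cast Nat.succ_ne_zero j)
  rw [← sub_eq_zero, ← hH]
  ext e
  rcases le_or_gt e k with he | he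
  · simpa using PowerSeries.X_pow_dvd_iff.1 (hlow (k + 1) le_rfl) e (by omega)
  · simp [hH, coeff_linProd_of_lt _ _ (hs.trans_lt he), coeff_linProd_of_lt _ _ (ht.trans_lt he)]

theorem exists_eq_of_linProd_eq {ι : Type*} {s t : Finset ι} {f : ι → ℂ}
    (h : linProd s f = linProd t f) {i : ι} (hi : i ∈ s) (h0 : f i ≠ 0) : ∃ j ∈ t, f i = f j := by
  have hcoe : ∀ s : Finset ι, linProd s f =
      ((∏ i ∈ s, (1 - Polynomial.C (f i) * Polynomial.X) : Polynomial ℂ) : PowerSeries ℂ) := by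
    intro s
    rw [← Polynomial.coeToPowerSeries.ringHom_apply, map_prod]
    simp [linProd]
  rw [hcoe, hcoe, Polynomial.coe_inj] at h
  have hev := congrArg (Polynomial.eval (f i)⁻¹) h
  rw [Polynomial.eval_prod, Polynomial.eval_prod,
    Finset.prod_eq_zero hi (by simp [h0])] at hev
  obtain ⟨j, hj, hj0⟩ := Finset.prod_eq_zero_iff.1 hev.symm
  refine ⟨j, hj, ?_⟩
  simp only [Polynomial.eval_sub, Polynomial.eval_one, Polynomial.eval_mul, Polynomial.eval_C,
    Polynomial.eval_X] at hj0
  field_simp at hj0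
  linear_combination hj0

theorem disjoint_of_sum_pow_eq {ι : Type*} [DecidableEq ι] {I J : Finset ι} {k : ℕ} {x : ι → ℂ}
    (hx : Function.Injective x) (hI : I.card = k) (hJ : J.card = k) (hIJ : I ≠ J)
    (h : ∀ j < k, ∑ i ∈ I, x i ^ j = ∑ i ∈ J, x i ^ j) : (I ∩ J).card = 0 := by
  by_contra hne
  have hI' := Finset.card_sdiff_add_card_inter I J
  have hJ' := Finset.card_sdiff_add_card_inter J I
  rw [Finset.inter_comm J I] at hJ'
  have hprod : linProd (I \ J) x = linProd (J \ I) x := by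
    refine linProd_eq_of_sum_pow_eq (k := k - 1) (by omega) (by omega) fun j _ hj => ?_
    have := h j (by omega)
    rw [← Finset.sum_inter_add_sum_sdiff I J, ← Finset.sum_inter_add_sum_sdiff J I,
      Finset.inter_comm J I] at this
    exact add_left_cancel this
  have hno : ∀ i ∈ I \ J, ∀ j ∈ J \ I, x i ≠ x j := by
    intro i hi j hj hij
    rw [hx hij] at hi
    exact (Finset.mem_sdiff.1 hi).2 (Finset.mem_sdiff.1 hj).1
  have hIn : (I \ J).Nonempty := by
    rw [Finset.sdiff_nonempty]
    exact fun hsub => hIJ (Finset.eq_of_subset_of_card_le hsub (by omega))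
  have hJn : (J \ I).Nonempty := by
    rw [Finset.sdiff_nonempty]
    exact fun hsub => hIJ (Finset.eq_of_subset_of_card_le hsub (by omega)).symm
  obtain ⟨i, hi⟩ := hIn
  obtain ⟨j, hj⟩ := hJn
  -- A zero value contributes the factor 1 and is invisible in `linProd`. Since `x i` and `x j`
  -- differ, at least one is nonzero and can be matched.
  by_cases h0 : x i = 0
  · have h0' : x j ≠ 0 := fun h' => hno i hi j hj (h0.trans h'.symm)
    obtain ⟨i', hi', he⟩ := exists_eq_of_linProd_eq hprod.symm hj h0'
    exact hno i' hi' j hj he.symm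
  · obtain ⟨j', hj', he⟩ := exists_eq_of_linProd_eq hprod hi h0
    exact hno i hi j' hj' he

theorem disjoint_of_sum_diagScalar_eq {I J : Finset (Fin n)} {k : ℕ} {b : Fin n → ℂ}
    (hb : Function.Injective b) (hI : I.card = k) (hJ : J.card = k) (hIJ : I ≠ J)
    (h : ∀ p, 2 ≤ p → p ≤ k → ∑ i, diagScalar (fun i => b i + if i ∈ I then 1 else 0) p i =
      ∑ i, diagScalar (fun i => b i + if i ∈ J then 1 else 0) p i) : (I ∩ J).card = 0 := by
  have h' : ∀ p ≤ k, ∑ i, diagScalar (fun i => b i + if i ∈ I then 1 else 0) p i =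
      ∑ i, diagScalar (fun i => b i + if i ∈ J then 1 else 0) p i := by
    intro p hp
    match p with
    | 0 => rfl
    | 1 => simp [diagScalar, Finset.sum_add_distrib, hI, hJ]
    | p + 2 => exact h (p + 2) (by omega) hp
  -- Raising b_i by 1 changes (z + 1)^q - z^q by a second difference centred at b_i + 1.
  refine disjoint_of_sum_pow_eq (x := fun i => b i + 1)
    (fun i j hij => hb (add_right_cancel hij)) hI hJ hIJ fun j hj => ?_
  refine sum_pow_eq_of_second_difference (x := fun i => b i + 1) (k := k) (fun q hq => ?_) j hj
  have h1 := sum_pow_sub_pow_eq h' q hq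
  rw [sum_add_indicator (fun z => (z + 1) ^ q - z ^ q),
    sum_add_indicator (fun z => (z + 1) ^ q - z ^ q)] at h1
  have h2 := add_left_cancel h1
  have e : ∀ z : ℂ, (z + 1 + 1) ^ q - 2 * (z + 1) ^ q + (z + 1 - 1) ^ q =
      (z + 1 + 1) ^ q - (z + 1) ^ q - ((z + 1) ^ q - z ^ q) := by
    intro z
    rw [add_sub_cancel_right]; ring
  simpa only [e] using h2

/-! ### Highest weight vectors in the polynomial ring on matrix entries -/

theorem derivation_prod {R A ι : Type*} [CommRing R] [CommRing A] [Algebra R A]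
    (D : Derivation R A A) [DecidableEq ι] (s : Finset ι) (f : ι → A) :
    D (∏ i ∈ s, f i) = ∑ a ∈ s, ∏ i ∈ s, if i = a then D (f i) else f i := by
  induction s using Finset.induction_on with
  | empty => simp
  | insert b s hb ih =>
    rw [Finset.prod_insert hb, Derivation.leibniz, ih, Finset.sum_insert hb,
      Finset.prod_insert hb, if_pos rfl, smul_eq_mul, smul_eq_mul, Finset.mul_sum, add_comm]
    congr 1
    · rw [mul_comm]
      congr 1
      exact Finset.prod_congr rfl fun i hi => by rw [if_neg (ne_of_mem_of_not_mem hi hb)]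
    · refine Finset.sum_congr rfl fun a ha => ?_
      rw [Finset.prod_insert hb, if_neg (ne_of_mem_of_not_mem ha hb).symm]

theorem derivation_det {R A ι : Type*} [CommRing R] [CommRing A] [Algebra R A]
    (D : Derivation R A A) [DecidableEq ι] [Fintype ι] (M : Matrix ι ι A) :
    D M.det = ∑ a, (M.updateCol a fun i => D (M i a)).det := by
  simp only [Matrix.det_apply, map_sum]
  rw [Finset.sum_comm]
  refine Finset.sum_congr rfl fun σ _ => ?_
  rw [← Finset.smul_sum, Units.smul_def, Units.smul_def, map_zsmul, derivation_prod]
  congr 1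
  refine Finset.sum_congr rfl fun a _ => Finset.prod_congr rfl fun i _ => ?_
  rw [Matrix.updateCol_apply]
  split_ifs with h
  · rw [h]
  · rfl

/-- The action of `sl_n(ℂ)` on the polynomials in the entries of an `n × n` matrix, by
left translation. -/
def polyAction (n : ℕ) :
    SL n →ₗ⁅ℂ⁆ Derivation ℂ (MvPolynomial (Fin n × Fin n) ℂ) (MvPolynomial (Fin n × Fin n) ℂ) where
  toFun A := MvPolynomial.mkDerivation ℂ fun q =>
    ∑ i, MvPolynomial.C (A.1 i q.1) * MvPolynomial.X (i, q.2)
  map_add' A B := by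
    refine MvPolynomial.derivation_ext fun q => ?_
    simp [MvPolynomial.mkDerivation_X, add_mul, Finset.sum_add_distrib]
  map_smul' c A := by
    refine MvPolynomial.derivation_ext fun q => ?_
    simp [MvPolynomial.mkDerivation_X, MvPolynomial.smul_eq_C_mul, Finset.mul_sum, mul_assoc]
  map_lie' := by
    intro A B
    refine MvPolynomial.derivation_ext fun q => ?_
    have key : ∀ A B : Matrix (Fin n) (Fin n) ℂ, ∑ l, MvPolynomial.C (B l q.1) *
        ∑ i, MvPolynomial.C (A i l) * MvPolynomial.X (R := ℂ) (i, q.2) =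
        ∑ i, MvPolynomial.C ((A * B) i q.1) * MvPolynomial.X (i, q.2) := by
      intro A B
      simp only [Matrix.mul_apply, map_sum, Finset.sum_mul, Finset.mul_sum]
      rw [Finset.sum_comm]
      refine Finset.sum_congr rfl fun i _ => Finset.sum_congr rfl fun l _ => ?_
      rw [map_mul]; ring
    have hb : (⁅A, B⁆ : SL n).1 = A.1 * B.1 - B.1 * A.1 := rfl
    rw [Derivation.commutator_apply]
    simp only [MvPolynomial.mkDerivation_X, map_sum, Derivation.leibniz, MvPolynomial.derivation_C,
      smul_eq_mul, mul_zero, add_zero, key, hb, Matrix.sub_apply, map_sub, sub_mul,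
      Finset.sum_sub_distrib]

instance : LieRingModule (SL n) (MvPolynomial (Fin n × Fin n) ℂ) :=
  LieRingModule.compLieHom _ (polyAction n)

instance : LieModule ℂ (SL n) (MvPolynomial (Fin n × Fin n) ℂ) :=
  LieModule.compLieHom _ (polyAction n)

theorem lie_poly (A : SL n) (f : MvPolynomial (Fin n × Fin n) ℂ) : ⁅A, f⁆ = polyAction n A f := rfl

theorem lie_poly_X (A : SL n) (q : Fin n × Fin n) :
    ⁅A, (MvPolynomial.X q : MvPolynomial (Fin n × Fin n) ℂ)⁆ =
      ∑ i, MvPolynomial.C (A.1 i q.1) * MvPolynomial.X (i, q.2) := by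
  rw [lie_poly]
  exact MvPolynomial.mkDerivation_X _ _ _

/-- `v` is annihilated by the positive root vectors and has weight `μ`. -/
def IsHighestWeightVector {V : Type*} [AddCommGroup V] [Module ℂ V] [LieRingModule (SL n) V]
    (μ : Weight n) (v : V) : Prop :=
  (∀ i j : Fin n, i < j → ⁅(X i j : SL n), v⁆ = 0) ∧ ∀ h : cartan n, ⁅(h : SL n), v⁆ = μ h • v

theorem IsHighestWeightVector.mul {μ ν : Weight n} {f g : MvPolynomial (Fin n × Fin n) ℂ}
    (hf : IsHighestWeightVector μ f) (hg : IsHighestWeightVector ν g) :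
    IsHighestWeightVector (μ + ν) (f * g) := by
  refine ⟨fun i j hij => ?_, fun h => ?_⟩
  · rw [lie_poly, Derivation.leibniz, ← lie_poly, ← lie_poly, hf.1 i j hij, hg.1 i j hij]
    simp
  · rw [lie_poly, Derivation.leibniz, ← lie_poly, ← lie_poly, hf.2, hg.2, LinearMap.add_apply,
      add_smul]
    simp only [smul_eq_mul, mul_smul_comm, mul_comm g f]
    rw [add_comm]

theorem isHighestWeightVector_one :
    IsHighestWeightVector (0 : Weight n) (1 : MvPolynomial (Fin n × Fin n) ℂ) :=
  ⟨fun i j _ => by simp [lie_poly], fun h => by simp [lie_poly]⟩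

theorem IsHighestWeightVector.pow {μ : Weight n} {f : MvPolynomial (Fin n × Fin n) ℂ}
    (hf : IsHighestWeightVector μ f) (c : ℕ) : IsHighestWeightVector (c • μ) (f ^ c) := by
  induction c with
  | zero => simpa using isHighestWeightVector_one
  | succ c ih =>
    rw [pow_succ, succ_nsmul]
    exact ih.mul hf

theorem IsHighestWeightVector.prod {ι : Type*} (s : Finset ι) {μ : ι → Weight n}
    {f : ι → MvPolynomial (Fin n × Fin n) ℂ} (hf : ∀ i ∈ s, IsHighestWeightVector (μ i) (f i)) :
    IsHighestWeightVector (∑ i ∈ s, μ i) (∏ i ∈ s, f i) := by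
  classical
  induction s using Finset.induction_on with
  | empty => simpa using isHighestWeightVector_one
  | insert a s ha ih =>
    rw [Finset.prod_insert ha, Finset.sum_insert ha]
    exact (hf a (Finset.mem_insert_self a s)).mul
      (ih fun i hi => hf i (Finset.mem_insert_of_mem hi))

/-- A matrix whose determinant is the principal minor of size `m` of the generic matrix. -/
def minorMatrix (n m : ℕ) : Matrix (Fin n) (Fin n) (MvPolynomial (Fin n × Fin n) ℂ) :=
  Matrix.of fun b a => if a.val < m then MvPolynomial.X (a, b) else if a = b then 1 else 0

theorem lie_minorMatrix (m : ℕ) (A : SL n) (b a : Fin n) :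
    ⁅A, minorMatrix n m b a⁆ =
      if a.val < m then ∑ i, MvPolynomial.C (A.1 i a) * MvPolynomial.X (i, b) else 0 := by
  rw [minorMatrix, Matrix.of_apply]
  split_ifs
  · exact lie_poly_X _ _
  · simp [lie_poly]
  · simp

theorem det_minorMatrix_ne_zero (m : ℕ) : (minorMatrix n m).det ≠ 0 := by
  intro h
  -- At the identity matrix every principal minor equals 1.
  have h1 := congrArg (MvPolynomial.eval fun q : Fin n × Fin n => if q.1 = q.2 then (1 : ℂ) else 0) h
  rw [RingHom.map_det, map_zero] at h1
  have h2 : (MvPolynomial.eval fun q : Fin n × Fin n =>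
      if q.1 = q.2 then (1 : ℂ) else 0).mapMatrix (minorMatrix n m) = 1 := by
    ext b a
    rw [RingHom.mapMatrix_apply, Matrix.map_apply, minorMatrix, Matrix.of_apply, Matrix.one_apply]
    by_cases hab : a = b
    · subst hab
      simp only [if_true]
      split_ifs <;> simp
    · simp only [if_neg hab, if_neg (Ne.symm hab)]
      split_ifs <;> simp [hab]
  rw [h2, Matrix.det_one] at h1
  exact one_ne_zero h1

/-- For i < j the root vector replaces column j by column i, which also lies in the minor when j
does, so the determinant has a repeated column. A diagonal matrix rescales each of the first m
columns by its diagonal entry. -/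
theorem isHighestWeightVector_minor (m : ℕ) :
    IsHighestWeightVector (fundamentalWeight n m) (minorMatrix n m).det := by
  refine ⟨fun i j hij => ?_, fun h => ?_⟩
  · rw [lie_poly, derivation_det]
    refine Finset.sum_eq_zero fun a _ => ?_
    simp only [← lie_poly, lie_minorMatrix]
    by_cases haj : a = j ∧ j.val < m
    · obtain ⟨rfl, ham⟩ := haj
      refine Matrix.det_zero_of_column_eq hij.ne fun b => ?_
      have him : i.val < m := lt_trans hij ham
      rw [Matrix.updateCol_ne hij.ne, Matrix.updateCol_self, if_pos ham, minorMatrix,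
        Matrix.of_apply, if_pos him, Finset.sum_eq_single i]
      · simp [X, hij.ne]
      · intro c _ hc
        simp [X, hij.ne, hc.symm]
      · simp
    · refine Matrix.det_eq_zero_of_column_eq_zero a fun b => ?_
      rw [Matrix.updateCol_self]
      split_ifs with ham
      · have hja : j ≠ a := fun h => haj ⟨h.symm, h ▸ ham⟩
        exact Finset.sum_eq_zero fun c _ => by simp [X, hij.ne, hja]
      · rfl
  · rw [lie_poly, derivation_det]
    simp only [← lie_poly, lie_minorMatrix]
    have hterm : ∀ a : Fin n, ((minorMatrix n m).updateCol a fun b =>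
        if a.val < m then ∑ i, MvPolynomial.C ((h : SL n).1 i a) * MvPolynomial.X (i, b)
          else 0).det =
        (if a.val < m then (h : SL n).1 a a else 0) • (minorMatrix n m).det := by
      intro a
      split_ifs with ham
      · have hcol : (fun b => ∑ i, MvPolynomial.C ((h : SL n).1 i a) *
            (MvPolynomial.X (i, b) : MvPolynomial (Fin n × Fin n) ℂ)) =
            (MvPolynomial.C ((h : SL n).1 a a) : MvPolynomial (Fin n × Fin n) ℂ) •
              fun b => minorMatrix n m b a := by
          funext b
          rw [Finset.sum_eq_single a]
          · simp [minorMatrix, ham]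
          · intro c _ hc
            rw [h.2 c a hc]; simp
          · simp
        rw [hcol, Matrix.det_updateCol_smul, MvPolynomial.smul_eq_C_mul]
        congr 2
        exact Matrix.updateCol_eq_self _ _
      · rw [zero_smul]
        exact Matrix.det_eq_zero_of_column_eq_zero a fun b => by rw [Matrix.updateCol_self]
    simp only [hterm]
    rw [← Finset.sum_smul, ← Finset.sum_filter]
    rfl

/-! ### Irreducible modules of dominant highest weight -/

theorem cartan_eq_sum (h : cartan n) : h = ∑ i, (h : SL n).1 i i • diagX i := by
  apply Subtype.ext
  conv_lhs => rw [sl_eq_sum (h : SL n)]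
  rw [AddSubmonoidClass.coe_finsetSum]
  refine Finset.sum_congr rfl fun i _ => ?_
  rw [Finset.sum_eq_single i]
  · rfl
  · intro j _ hj
    rw [h.2 i j hj.symm, zero_smul]
  · simp

theorem coroot_eq (j j' : Fin n) : coroot j j' = diagX j - diagX j' := rfl

/-- Summation by parts in μ(h) = ∑ μ(X_ii) h_ii: the differences are coroot values, the partial sums
are fundamental weights, and the boundary term is the trace, hence zero. -/
theorem IsDominantIntegral.eq_sum {μ : Weight n} (hμ : IsDominantIntegral μ) :
    ∃ c : ℕ → ℕ, μ = ∑ j ∈ Finset.range (n - 1), c j • fundamentalWeight n (j + 1) := by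
  set M : ℕ → ℂ := fun i => if hi : i < n then μ (diagX ⟨i, hi⟩) else 0 with hM
  have hc : ∀ j, ∃ c : ℕ, j + 1 < n → M j - M (j + 1) = c := by
    intro j
    by_cases hj : j + 1 < n
    · obtain ⟨c, hc⟩ := hμ ⟨j, by omega⟩ ⟨j + 1, hj⟩ rfl
      refine ⟨c, fun _ => ?_⟩
      rw [coroot_eq, map_sub] at hc
      simp only [hM, dif_pos hj, dif_pos (Nat.lt_of_succ_lt hj)]
      exact hc
    · exact ⟨0, fun h => absurd h hj⟩
  choose c hc using hc
  refine ⟨c, LinearMap.ext fun h => ?_⟩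
  set H : ℕ → ℂ := fun i => if hi : i < n then (h : SL n).1 ⟨i, hi⟩ ⟨i, hi⟩ else 0 with hH
  have hω : ∀ m ≤ n, fundamentalWeight n m h = ∑ i ∈ Finset.range m, H i := by
    intro m hm
    change ∑ a : Fin n with a.val < m, (h : SL n).1 a a = _
    rw [Finset.sum_filter]
    have : ∀ a : Fin n, (if a.val < m then (h : SL n).1 a a else 0) =
        (fun i : ℕ => if i < m then H i else 0) a := by
      intro a
      simp [hH]
    simp only [this]
    rw [Fin.sum_univ_eq_sum_range (fun i : ℕ => if i < m then H i else 0) n, ← Finset.sum_filter]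
    congr 1
    ext i
    simp only [Finset.mem_filter, Finset.mem_range]
    omega
  have htr : ∑ i ∈ Finset.range n, H i = 0 := by
    rw [← Fin.sum_univ_eq_sum_range]
    have h0 : ∑ i, (h : SL n).1 i i = 0 := (h : SL n).2
    simpa [hH] using h0
  have h1 : μ h = ∑ i ∈ Finset.range n, M i • H i := by
    conv_lhs => rw [cartan_eq_sum h]
    rw [map_sum, ← Fin.sum_univ_eq_sum_range (fun i => M i • H i)]
    refine Finset.sum_congr rfl fun i _ => ?_
    simp [hM, hH, mul_comm]
  rw [h1, Finset.sum_range_by_parts, htr, smul_zero, zero_sub, ← Finset.sum_neg_distrib,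
    LinearMap.sum_apply]
  refine Finset.sum_congr rfl fun j hj => ?_
  have hj' : j + 1 < n := by have := Finset.mem_range.1 hj; omega
  rw [LinearMap.smul_apply, hω _ hj'.le, nsmul_eq_mul, ← hc j hj', smul_eq_mul]
  ring

theorem IsDominantIntegral.exists_isHighestWeightVector {μ : Weight n}
    (hμ : IsDominantIntegral μ) :
    ∃ f : MvPolynomial (Fin n × Fin n) ℂ, f ≠ 0 ∧ IsHighestWeightVector μ f := by
  obtain ⟨c, rfl⟩ := hμ.eq_sum
  exact ⟨∏ j ∈ Finset.range (n - 1), (minorMatrix n (j + 1)).det ^ c j,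
    Finset.prod_ne_zero_iff.2 fun j _ => pow_ne_zero _ (det_minorMatrix_ne_zero _),
    .prod _ fun j _ => (isHighestWeightVector_minor _).pow _⟩

/-- The submodule generated by `v` is cyclic, so it has a maximal proper submodule. The quotient is
irreducible, and the generator survives in it. -/
theorem exists_isIrreducibleOfHighestWeight {V : Type} [AddCommGroup V] [Module ℂ V]
    [LieRingModule (SL n) V] [LieModule ℂ (SL n) V] {μ : Weight n} {v : V} (hv0 : v ≠ 0)
    (hv : IsHighestWeightVector μ v) :
    ∃ (W : Type) (_ : AddCommGroup W) (_ : Module ℂ W) (_ : LieRingModule (SL n) W)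
      (_ : LieModule ℂ (SL n) W), IsIrreducibleOfHighestWeight W μ := by
  set N := LieSubmodule.lieSpan ℂ (SL n) ({v} : Set V)
  let w : N := ⟨v, LieSubmodule.subset_lieSpan rfl⟩
  have hgen : LieSubmodule.lieSpan ℂ (SL n) ({w} : Set N) = ⊤ := by
    rw [eq_top_iff]
    intro x _
    have hle : N ≤ (LieSubmodule.lieSpan ℂ (SL n) ({w} : Set N)).map N.incl := by
      refine LieSubmodule.lieSpan_le.2 (Set.singleton_subset_iff.2 ?_)
      exact (LieSubmodule.mem_map _).2 ⟨w, LieSubmodule.subset_lieSpan rfl, rfl⟩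
    obtain ⟨y, hy, hyx⟩ := (LieSubmodule.mem_map _).1 (hle x.2)
    rwa [← Subtype.ext (a1 := y) (a2 := x) hyx]
  have hco : IsCoatomic (LieSubmodule ℂ (SL n) N) := by
    apply CompleteLattice.coatomic_of_top_compact
    rw [← hgen]
    exact LieSubmodule.isCompactElement_lieSpan_singleton ℂ (SL n) w
  have hw0 : w ≠ 0 := fun h => hv0 (congrArg Subtype.val h)
  obtain ⟨K, hK, -⟩ := (eq_top_or_exists_le_coatom (⊥ : LieSubmodule ℂ (SL n) N)).resolve_left
    fun h => hw0 <| by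
      have : w ∈ (⊥ : LieSubmodule ℂ (SL n) N) := h ▸ LieSubmodule.mem_top w
      simpa using this
  have hwK : w ∉ K := fun h => hK.1 <| by
    rw [eq_top_iff, ← hgen, LieSubmodule.lieSpan_le, Set.singleton_subset_iff]
    exact h
  have hq0 : LieSubmodule.Quotient.mk' K w ≠ 0 := fun h =>
    hwK (LieSubmodule.Quotient.mk_eq_zero K |>.1 h)
  refine ⟨N ⧸ K, inferInstance, inferInstance, inferInstance, inferInstance, ?_,
    LieSubmodule.Quotient.mk' K w, hq0, fun i j hij => ?_, fun h => ?_⟩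
  · have : Nontrivial (N ⧸ K) := ⟨_, _, hq0⟩
    refine LieModule.IsIrreducible.mk fun P hP => ?_
    have hKP : K ≤ P.comap (LieSubmodule.Quotient.mk' K) := by
      intro x hx
      rw [LieSubmodule.mem_comap, (LieSubmodule.Quotient.mk_eq_zero K).2 hx]
      exact P.zero_mem
    rcases hKP.eq_or_lt with h | h
    · refine absurd ?_ hP
      rw [eq_bot_iff]
      intro y hy
      obtain ⟨x, rfl⟩ := LieSubmodule.Quotient.surjective_mk' K y
      have hx : x ∈ K := h ▸ LieSubmodule.mem_comap.2 hy
      rw [(LieSubmodule.Quotient.mk_eq_zero K).2 hx]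
      exact LieSubmodule.zero_mem _
    · have h' := hK.2 _ h
      rw [eq_top_iff]
      intro y _
      obtain ⟨x, rfl⟩ := LieSubmodule.Quotient.surjective_mk' K y
      exact LieSubmodule.mem_comap.1 (h' ▸ LieSubmodule.mem_top x)
  · rw [← LieModuleHom.map_lie]
    have : ⁅(X i j : SL n), w⁆ = 0 := Subtype.ext (hv.1 i j hij)
    rw [this, map_zero]
  · rw [← LieModuleHom.map_lie]
    have : ⁅(h : SL n), w⁆ = μ h • w := Subtype.ext (hv.2 h)
    rw [this, map_smul]

theorem IsIrreducibleOfHighestWeight.eq_casimirScalar {V : Type*} [AddCommGroup V] [Module ℂ V]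
    [LieRingModule (SL n) V] [LieModule ℂ (SL n) V] {μ : Weight n}
    (hV : IsIrreducibleOfHighestWeight V μ) {p : ℕ} {c : ℂ}
    (hc : ∀ v : V, envRep V (casimir n p) v = c • v) : c = casimirScalar μ p := by
  obtain ⟨v, hv0, -⟩ := hV.2
  exact smul_left_injective ℂ hv0 ((hc v).symm.trans (hV.envRep_casimir p v))

/-- Existence of a module makes the choice in `infChar` meaningful; any module it selects then
forces the same scalar. -/
theorem infChar_casimir {μ : Weight n} (hμ : IsDominantIntegral μ) (p : ℕ) :
    infChar μ (casimir n p) = casimirScalar μ p := by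
  obtain ⟨f, hf0, hf⟩ := hμ.exists_isHighestWeightVector
  obtain ⟨W, i1, i2, i3, i4, hW⟩ := exists_isIrreducibleOfHighestWeight hf0 hf
  obtain ⟨V, _, _, _, _, hV, hc⟩ := Classical.epsilon_spec (p := fun c : ℂ =>
    ∃ (V : Type) (_ : AddCommGroup V) (_ : Module ℂ V) (_ : LieRingModule (SL n) V)
      (_ : LieModule ℂ (SL n) V),
      IsIrreducibleOfHighestWeight V μ ∧ ∀ v : V, envRep V (casimir n p) v = c • v)
    ⟨casimirScalar μ p, W, i1, i2, i3, i4, hW, hW.envRep_casimir p⟩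
  exact hV.eq_casimirScalar hc

/-! ### Coordinates of the weights and the combinatorial conclusion -/

theorem fundamentalWeight_diagX (m : ℕ) (j : Fin n) :
    fundamentalWeight n m (diagX j) =
      (if j.val < m then 1 else 0) - ∑ a : Fin n with a.val < m, 1 / (n : ℂ) := by
  change ∑ a : Fin n with a.val < m, (X j j : SL n).1 a a = _
  simp only [X, if_true, Matrix.sub_apply, Matrix.smul_apply, Matrix.one_apply_eq, smul_eq_mul,
    mul_one, Finset.sum_sub_distrib]
  congr 1
  simp only [Matrix.single_apply, and_self]
  rw [Finset.sum_ite_eq]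
  simp

theorem subsetWeight_diagX (I : Finset (Fin n)) (j : Fin n) :
    subsetWeight I (diagX j) = (if j ∈ I then 1 else 0) - I.card * (1 / (n : ℂ)) := by
  have h1 : ∀ i : Fin n, (-fundamentalWeight n i + fundamentalWeight n (i + 1)) (diagX j) =
      (if j = i then 1 else 0) - 1 / (n : ℂ) := by
    intro i
    have hfilter : (Finset.univ.filter fun a : Fin n => a.val < i.val + 1) =
        insert i (Finset.univ.filter fun a : Fin n => a.val < i.val) := by
      ext a
      simp only [Finset.mem_filter, Finset.mem_univ, true_and, Finset.mem_insert, Fin.ext_iff]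
      omega
    rw [LinearMap.add_apply, LinearMap.neg_apply, fundamentalWeight_diagX,
      fundamentalWeight_diagX, hfilter, Finset.sum_insert (by simp)]
    rcases lt_trichotomy j i with h | rfl | h
    · rw [if_pos (show j.val < i.val from h),
        if_pos (show j.val < i.val + 1 from Nat.lt_succ_of_lt h), if_neg h.ne]
      ring
    · rw [if_neg (lt_irrefl _), if_pos (Nat.lt_succ_self _), if_pos rfl]
      ring
    · rw [if_neg (show ¬ j.val < i.val from h.le.not_gt),
        if_neg (show ¬ j.val < i.val + 1 from (Nat.succ_le_of_lt h).not_gt), if_neg h.ne']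
      ring
  rw [subsetWeight, LinearMap.sum_apply, Finset.sum_congr rfl fun i _ => h1 i,
    Finset.sum_sub_distrib]
  simp

theorem shiftedCoord_add_subsetWeight (ν : Weight n) (I : Finset (Fin n)) :
    shiftedCoord (ν + subsetWeight I) = fun i =>
      (shiftedCoord ν i - I.card * (1 / (n : ℂ))) + if i ∈ I then 1 else 0 := by
  funext i
  rw [shiftedCoord, LinearMap.add_apply, subsetWeight_diagX, shiftedCoord]
  ring

theorem IsDominantIntegral.exists_sub {ν : Weight n} (hν : IsDominantIntegral ν) {i j : Fin n}
    (hij : i ≤ j) : ∃ a : ℕ, ν (diagX i) - ν (diagX j) = a := by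
  obtain ⟨j, hj⟩ := j
  induction j with
  | zero =>
    have : i = ⟨0, hj⟩ := le_antisymm hij (Nat.zero_le _)
    exact ⟨0, by simp [this]⟩
  | succ j ih =>
    rcases hij.eq_or_lt with rfl | hlt
    · exact ⟨0, by simp⟩
    · obtain ⟨a, ha⟩ := ih (Nat.lt_of_succ_lt hj) (Nat.le_of_lt_succ hlt)
      obtain ⟨b, hb⟩ := hν ⟨j, Nat.lt_of_succ_lt hj⟩ ⟨j + 1, hj⟩ rfl
      rw [coroot_eq, map_sub] at hb
      exact ⟨a + b, by push_cast; linear_combination ha + hb⟩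

/-- Dominance makes the coordinates weakly decreasing, and the shift n - 1 - i makes them strictly
so. -/
theorem IsDominantIntegral.shiftedCoord_injective {ν : Weight n} (hν : IsDominantIntegral ν) :
    Function.Injective (shiftedCoord ν) := by
  have key : ∀ i j : Fin n, i < j → shiftedCoord ν i ≠ shiftedCoord ν j := by
    intro i j hij h
    obtain ⟨a, ha⟩ := hν.exists_sub hij.le
    have h1 : ((a + (n - 1 - i) : ℕ) : ℂ) = ((n - 1 - j : ℕ) : ℂ) := by
      simp only [shiftedCoord] at h
      rw [Nat.cast_add]
      linear_combination h - ha
    have h2 := Nat.cast_injective h1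
    have h3 : i.val < j.val := hij
    have h4 := j.isLt
    omega
  intro i j h
  rcases lt_trichotomy i j with hij | hij | hij
  · exact absurd h (key i j hij)
  · exact hij
  · exact absurd h.symm (key j i hij)

theorem disjoint_of_casimirScalar_eq {ν : Weight n} (hν : IsDominantIntegral ν) {k : ℕ}
    {I J : Finset (Fin n)} (hI : I.card = k) (hJ : J.card = k) (hIJ : I ≠ J)
    (h : ∀ p, 2 ≤ p → p ≤ k →
      casimirScalar (ν + subsetWeight I) p = casimirScalar (ν + subsetWeight J) p) :
    (I ∩ J).card = 0 := by
  simp only [casimirScalar, shiftedCoord_add_subsetWeight, hI, hJ] at h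
  exact disjoint_of_sum_diagScalar_eq
    (fun i j hij => hν.shiftedCoord_injective (sub_left_injective hij)) hI hJ hIJ h

/-! ### Kostant's operators on constituents of the tensor product -/

section Tensor

variable {V : Type*} [AddCommGroup V] [Module ℂ V] [LieRingModule (SL n) V]
  [LieModule ℂ (SL n) V]

theorem envRep_coe (A : LieSubmodule ℂ (SL n) V) (z : Env n) (x : A) :
    ((envRep A z x : A) : V) = envRep V z x := by
  let E : Subalgebra ℂ (Env n) :=
    { carrier := {z | ∀ x : A, ((envRep A z x : A) : V) = envRep V z x}
      mul_mem' := by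
        intro a b ha hb x
        rw [map_mul, map_mul, Module.End.mul_apply, Module.End.mul_apply, ha, hb]
      add_mem' := by
        intro a b ha hb x
        rw [map_add, map_add, LinearMap.add_apply, LinearMap.add_apply, LieSubmodule.coe_add,
          ha, hb]
      algebraMap_mem' := by
        intro c x
        rw [AlgHom.commutes, AlgHom.commutes, Module.algebraMap_end_apply,
          Module.algebraMap_end_apply, LieSubmodule.coe_smul] }
  let ιE : SL n →ₗ⁅ℂ⁆ E :=
    { toFun := fun y => ⟨UniversalEnvelopingAlgebra.ι ℂ y, fun x => by
        rw [envRep_ι, envRep_ι, LieSubmodule.coe_bracket]⟩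
      map_add' := fun a b => Subtype.ext (map_add _ a b)
      map_smul' := fun c a => Subtype.ext (map_smul _ c a)
      map_lie' := fun {a b} => Subtype.ext (LieHom.map_lie _ a b) }
  -- `E`, the subalgebra where the two actions agree, contains the generators; by the universal
  -- property its inclusion has a section, so `E` is the whole algebra.
  have hcomp : E.val.comp (UniversalEnvelopingAlgebra.lift ℂ ιE) = AlgHom.id ℂ (Env n) := by
    apply UniversalEnvelopingAlgebra.hom_ext
    ext y
    simp [ιE]
  have hz : z ∈ E := by
    have h := DFunLike.congr_fun hcomp z
    rw [AlgHom.id_apply] at h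
    rw [← h]
    exact (UniversalEnvelopingAlgebra.lift ℂ ιE z).2
  exact hz x

variable {W : Type*} [AddCommGroup W] [Module ℂ W] [LieRingModule (SL n) W]
  [LieModule ℂ (SL n) W]

theorem kostantOperator_casimir_apply {μ ν κ : Weight n} {A : LieSubmodule ℂ (SL n) (V ⊗[ℂ] W)}
    (hV : IsIrreducibleOfHighestWeight V μ) (hW : IsIrreducibleOfHighestWeight W ν)
    (hA : IsIrreducibleOfHighestWeight A κ) (p : ℕ) {x : V ⊗[ℂ] W} (hx : x ∈ A) :
    kostantOperator V W (casimir n p) x =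
      (casimirScalar κ p - casimirScalar μ p - casimirScalar ν p) • x := by
  have h1 : envRep V (casimir n p) = casimirScalar μ p • LinearMap.id :=
    LinearMap.ext fun v => hV.envRep_casimir p v
  have h2 : envRep W (casimir n p) = casimirScalar ν p • LinearMap.id :=
    LinearMap.ext fun v => hW.envRep_casimir p v
  have h3 : envRep (V ⊗[ℂ] W) (casimir n p) x = casimirScalar κ p • x := by
    have h := congrArg Subtype.val (hA.envRep_casimir p ⟨x, hx⟩)
    rwa [envRep_coe] at h
  rw [kostantOperator, h1, h2, TensorProduct.map_smul_left, TensorProduct.map_smul_right,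
    TensorProduct.map_id, LinearMap.sub_apply, LinearMap.sub_apply, h3, sub_smul, sub_smul]
  rfl

end Tensor

end PTE

end

theorem corollary6p4 (n k : ℕ) (hk : 1 ≤ k) (hkn : k + k ≤ n)
    (ν : PTE.Weight n) (hν : PTE.IsDominantIntegral ν)
    (I J : Finset (Fin n)) (hI : I.card = k) (hJ : J.card = k) (hIJ : I ≠ J)
    (hνI : PTE.IsDominantIntegral (ν + PTE.subsetWeight I))
    (hνJ : PTE.IsDominantIntegral (ν + PTE.subsetWeight J)) :
    -- version with the eigenvalues given by infinitesimal characters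
    ((∀ p : ℕ, 2 ≤ p → p ≤ k →
        PTE.casimirEigenvalue k ν p I = PTE.casimirEigenvalue k ν p J) →
      (I ∩ J).card = 0) ∧
    -- version with the operators on the constituents of the tensor product
    (∀ (V : Type*) [AddCommGroup V] [Module ℂ V] [LieRingModule (PTE.SL n) V]
        [LieModule ℂ (PTE.SL n) V]
        (W : Type*) [AddCommGroup W] [Module ℂ W] [LieRingModule (PTE.SL n) W]
        [LieModule ℂ (PTE.SL n) W]
        (A B : LieSubmodule ℂ (PTE.SL n) (TensorProduct ℂ V W)),
      PTE.IsIrreducibleOfHighestWeight V (PTE.fundamentalWeight n k) →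
      PTE.IsIrreducibleOfHighestWeight W ν →
      PTE.IsIrreducibleOfHighestWeight A (ν + PTE.subsetWeight I) →
      PTE.IsIrreducibleOfHighestWeight B (ν + PTE.subsetWeight J) →
      (∀ p : ℕ, 2 ≤ p → p ≤ k → ∃ c : ℂ,
        (∀ x ∈ A, PTE.kostantOperator V W (PTE.casimir n p) x = c • x) ∧
        (∀ x ∈ B, PTE.kostantOperator V W (PTE.casimir n p) x = c • x)) →
      (I ∩ J).card = 0) := by
  refine ⟨fun h => ?_, ?_⟩
  · refine PTE.disjoint_of_casimirScalar_eq hν hI hJ hIJ fun p hp hpk => ?_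
    have h1 := h p hp hpk
    rw [PTE.casimirEigenvalue, PTE.casimirEigenvalue, PTE.infChar_casimir hνI,
      PTE.infChar_casimir hνJ] at h1
    -- The terms for ν and ω_k do not depend on the subset, so they cancel without being evaluated.
    exact sub_left_injective (sub_left_injective h1)
  · intro V _ _ _ _ W _ _ _ _ A B hV hW hA hB h
    refine PTE.disjoint_of_casimirScalar_eq hν hI hJ hIJ fun p hp hpk => ?_
    obtain ⟨c, hcA, hcB⟩ := h p hp hpk
    have key : ∀ (κ : PTE.Weight n) (C : LieSubmodule ℂ (PTE.SL n) (TensorProduct ℂ V W)),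
        PTE.IsIrreducibleOfHighestWeight C κ →
        (∀ x ∈ C, PTE.kostantOperator V W (PTE.casimir n p) x = c • x) →
        PTE.casimirScalar κ p - PTE.casimirScalar (PTE.fundamentalWeight n k) p -
          PTE.casimirScalar ν p = c := by
      intro κ C hC hc
      obtain ⟨v, hv0, -⟩ := hC.2
      have hv0' : (v : TensorProduct ℂ V W) ≠ 0 := fun h => hv0 (Subtype.ext h)
      exact smul_left_injective ℂ hv0'
        ((PTE.kostantOperator_casimir_apply hV hW hC p v.2).symm.trans (hc v v.2))
    exact sub_left_injective (sub_left_injective ((key _ A hA hcA).trans (key _ B hB hcB).symm))
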